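/- Let $n \ge 2$ be an integer, let $BS(1,n) = \langle a, b : a b a^{-1} = b^n\rangle$, and let $\mathbb{T}^2 = \mathbb{R}^2/\mathbb{Z}^2$. A homeomorphism $h$ of $\mathbb{T}^2$ is called Anosov with stretch factor $\lambda > 1$ if there is a pair of transverse (nonsingular) measured foliations $(\mathcal{F}^s,\mu^s)$, $(\mathcal{F}^u,\mu^u)$ of $\mathbb{T}^2$ that are invariant under $h$ and whose transverse measures are multiplied by $h$ by $\lambda$ and $\lambda^{-1}$ respectively; that is, $\mathbb{T}^2$ is covered by charts into $\mathbb{R}^2$, with changes of charts locally of the form $(x,y)\mapsto(\pm x+c,\pm y+d)$ (so that $\mathcal{F}^s=\{x=\mathrm{const}\}$, $\mu^s=|dx|$, $\mathcal{F}^u=\{y=\mathrm{const}\}$, $\mu^u=|dy|$ are well defined), in which $h$ is locally of the form $(x,y)\mapsto(\pm\lambda x+c,\pm\lambda^{-1}y+d)$. Theorem. There is no faithful representation of $BS(1,n)$ by homeomorphisms of $\mathbb{T}^2$ in which the conjugating element acts as an Anosov homeomorphism with stretch factor $\lambda>n$: if $\rho: BS(1,n)\to \mathrm{Homeo}(\mathbb{T}^2)$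 is a homomorphism and $h=\rho(a)$ is Anosov with stretch factor $\lambda>n$, then $\rho$ is not injective. -/

import Mathlib

open scoped Topology

/-- The Baumslag-Solitar group `BS(m, n) = ⟨a, b : a b^m a⁻¹ = b^n⟩`, as a presented group; the
generator `a` has index `0` and the generator `b` has index `1`. -/
abbrev BaumslagSolitar (m n : ℤ) : Type :=
  PresentedGroup
    ({FreeGroup.of 0 * FreeGroup.of 1 ^ m * (FreeGroup.of 0)⁻¹ * (FreeGroup.of 1 ^ n)⁻¹} :
      Set (FreeGroup (Fin 2)))

/-- The generator `a` (the conjugating element) of `BS(m, n)`. -/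
def BaumslagSolitar.a (m n : ℤ) : BaumslagSolitar m n := PresentedGroup.of 0

/-- The generator `b` of `BS(m, n)`. -/
def BaumslagSolitar.b (m n : ℤ) : BaumslagSolitar m n := PresentedGroup.of 1

/-- The two-dimensional torus `(ℝ/ℤ) × (ℝ/ℤ)`. -/
abbrev Torus2 : Type := UnitAddCircle × UnitAddCircle

/-- Read in the plane charts `e` (near `p`) and `e'` (near `g p`), the map `g` has, near `p`, the
form `(x, y) ↦ (± s x + c, ± t y + d)`, with independent signs. -/
def ScalesCharts {X : Type*} [TopologicalSpace X] (s t : ℝ) (g : X → X)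
    (e e' : OpenPartialHomeomorph X (ℝ × ℝ)) (p : X) : Prop :=
  ∃ ε δ c d : ℝ, (ε = 1 ∨ ε = -1) ∧ (δ = 1 ∨ δ = -1) ∧
    ∀ᶠ q in 𝓝 p, e' (g q) = (ε * s * (e q).1 + c, δ * t * (e q).2 + d)

/-- A pair of transverse (nonsingular) measured foliations `(Fˢ, μˢ)`, `(Fᵘ, μᵘ)` of a surface `X`,
given by its foliation charts. In each chart the leaves of `Fˢ` are the vertical lines
`x = const`, with transverse measure `μˢ = |dx|`, and the leaves of `Fᵘ` are the horizontal lines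
`y = const`, with transverse measure `μᵘ = |dy|`. The charts agree on these data, that is, the
changes of charts are locally of the form `(x, y) ↦ (± x + c, ± y + d)`. -/
structure TransverseMeasuredFoliations (X : Type*) [TopologicalSpace X] where
  charts : Set (OpenPartialHomeomorph X (ℝ × ℝ))
  covers : ∀ p : X, ∃ e ∈ charts, p ∈ e.source
  compatible : ∀ e ∈ charts, ∀ e' ∈ charts, ∀ p ∈ e.source ∩ e'.source,
    ScalesCharts 1 1 id e e' p

/-- `h` is an Anosov homeomorphism of the torus with stretch factor `lam > 1`: there are transverse
measured foliations `(Fˢ, μˢ)` and `(Fᵘ, μᵘ)` that `h` leaves invariant, multiplying the transverse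
measure of the first by `lam` and that of the second by `lam⁻¹`. Hence `h` contracts
the leaves of `Fˢ` (along which `μᵘ` measures length) by the factor `lam` and expands those of `Fᵘ`
by the factor `lam`. -/
def IsAnosovWithStretchFactor (h : Torus2 ≃ₜ Torus2) (lam : ℝ) : Prop :=
  1 < lam ∧ ∃ F : TransverseMeasuredFoliations Torus2,
    ∀ e ∈ F.charts, ∀ e' ∈ F.charts, ∀ p ∈ e.source, h p ∈ e'.source →
      ScalesCharts lam lam⁻¹ h e e' p

/-! Write `f = ρ(b)`, so that `h f = f ^ n h`. The proof shows that `f` has finite order, whereas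
`b` has infinite order in `BS(1, n)`.

The foliation charts develop to a local homeomorphism `D` of the plane. Deck translations become
signed isometries, so even lattice vectors become translations, recorded by a period matrix `C`. A
lift `H` of `h` becomes a map `T` with linear part `diag(p, q)`, where `|p| = λ` and `|q| = λ⁻¹`.
Hyperbolicity makes `C` invertible (`det_periodMatrix_ne_zero`), so `D` stays at bounded distance
from a linear isomorphism. It is therefore proper, and a homeomorphism.

On the lattice, `diag(p, q)` conjugates the real form of the matrix of `f` to its `n`-th power. This
makes the matrix an involution (`Matrix.sq_eq_one_of_diagonal_mul_eq`), and a lift of `f ^ 2`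
commutes with deck translations. Since `n` is not an eigenvalue of the action of `H`, a power of
this lift times a deck translation satisfies the relation exactly (`exists_corrected_lift`).

In the coordinate `D` the corrected lift has bounded displacement, and
`eq_self_of_isSignedScaling_conj` makes it the identity. The `x`-displacement of an `n`-th power
grows at most `n` times, while `T` stretches it by `λ > n`, so it vanishes. The map is then monotone
on vertical lines, where an `n`-th power moves points at least as far as the map, while `T`
contracts. -/

/-! ### Signed diagonal affine maps of the plane -/

/-- The maps `(x, y) ↦ (± s x + c, ± t y + d)` of the plane. -/
def IsSignedScaling (s t : ℝ) (T : ℝ × ℝ → ℝ × ℝ) : Prop :=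
  ∃ ε δ c d : ℝ, (ε = 1 ∨ ε = -1) ∧ (δ = 1 ∨ δ = -1) ∧
    ∀ z, T z = (ε * s * z.1 + c, δ * t * z.2 + d)

theorem scalesCharts_iff {X : Type*} [TopologicalSpace X] {s t : ℝ} {g : X → X}
    {e e' : OpenPartialHomeomorph X (ℝ × ℝ)} {p : X} :
    ScalesCharts s t g e e' p ↔
      ∃ T, IsSignedScaling s t T ∧ ∀ᶠ q in 𝓝 p, e' (g q) = T (e q) := by
  constructor
  · rintro ⟨ε, δ, c, d, hε, hδ, h⟩
    exact ⟨fun z => (ε * s * z.1 + c, δ * t * z.2 + d), ⟨ε, δ, c, d, hε, hδ, fun _ => rfl⟩, h⟩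
  · rintro ⟨T, ⟨ε, δ, c, d, hε, hδ, hT⟩, h⟩
    refine ⟨ε, δ, c, d, hε, hδ, ?_⟩
    filter_upwards [h] with q hq
    rw [hq, hT]

theorem mul_eq_one_or_neg_one {a b : ℝ} (ha : a = 1 ∨ a = -1) (hb : b = 1 ∨ b = -1) :
    a * b = 1 ∨ a * b = -1 := by
  rcases ha with rfl | rfl <;> rcases hb with rfl | rfl <;> norm_num

namespace IsSignedScaling

variable {s t s' t' : ℝ} {T T' : ℝ × ℝ → ℝ × ℝ}

theorem id : IsSignedScaling 1 1 id :=
  ⟨1, 1, 0, 0, .inl rfl, .inl rfl, fun z => by simp⟩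

theorem comp (hT' : IsSignedScaling s' t' T') (hT : IsSignedScaling s t T) :
    IsSignedScaling (s' * s) (t' * t) (T' ∘ T) := by
  obtain ⟨ε, δ, c, d, hε, hδ, h⟩ := hT
  obtain ⟨ε', δ', c', d', hε', hδ', h'⟩ := hT'
  refine ⟨ε' * ε, δ' * δ, ε' * s' * c + c', δ' * t' * d + d', mul_eq_one_or_neg_one hε' hε,
    mul_eq_one_or_neg_one hδ' hδ, fun z => ?_⟩
  simp only [Function.comp_apply, h, h', Prod.mk.injEq]
  constructor <;> ring

theorem continuous (hT : IsSignedScaling s t T) : Continuous T := by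
  obtain ⟨ε, δ, c, d, -, -, h⟩ := hT
  rw [funext h]
  fun_prop

theorem exists_inverse (hT : IsSignedScaling s t T) (hs : s ≠ 0) (ht : t ≠ 0) :
    ∃ T', IsSignedScaling s⁻¹ t⁻¹ T' ∧ (∀ z, T' (T z) = z) ∧ ∀ z, T (T' z) = z := by
  obtain ⟨ε, δ, c, d, hε, hδ, h⟩ := hT
  refine ⟨fun z => (ε * s⁻¹ * z.1 + -(ε * s⁻¹ * c), δ * t⁻¹ * z.2 + -(δ * t⁻¹ * d)),
    ⟨ε, δ, _, _, hε, hδ, fun z => rfl⟩, fun z => ?_, fun z => ?_⟩ <;>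
  · rw [h]
    rcases hε with rfl | rfl <;> rcases hδ with rfl | rfl <;>
      (ext <;> simp <;> field_simp <;> ring)

/-- A signed scaling with nonzero factors, as a homeomorphism of the plane. -/
theorem exists_homeomorph (hT : IsSignedScaling s t T) (hs : s ≠ 0) (ht : t ≠ 0) :
    ∃ e : ℝ × ℝ ≃ₜ ℝ × ℝ, ∀ z, e z = T z := by
  obtain ⟨T', hT', h1, h2⟩ := hT.exists_inverse hs ht
  exact ⟨⟨⟨T, T', h1, h2⟩, hT.continuous, hT'.continuous⟩, fun _ => rfl⟩

/-- Two points that differ in both coordinates determine a diagonal affine map, and every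
neighbourhood contains such a pair. This rigidity lets local relations become global. -/
theorem eq_of_eventuallyEq (hT : IsSignedScaling s t T) (hT' : IsSignedScaling s' t' T')
    {z : ℝ × ℝ} (h : ∀ᶠ w in 𝓝 z, T w = T' w) : T = T' := by
  obtain ⟨ε, δ, c, d, -, -, hT⟩ := hT
  obtain ⟨ε', δ', c', d', -, -, hT'⟩ := hT'
  obtain ⟨r, hr, hball⟩ := Metric.eventually_nhds_iff_ball.1 h
  have h0 := hball z (Metric.mem_ball_self hr)
  have h1 := hball (z + (r / 2, r / 2)) (by
    rw [mem_ball_iff_norm, add_sub_cancel_left, Prod.norm_def]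
    simp [abs_of_pos hr]; exact hr)
  simp only [hT, hT', Prod.mk.injEq, Prod.fst_add, Prod.snd_add] at h0 h1
  have e1 : ε * s = ε' * s' := by
    have : (ε * s - ε' * s') * (r / 2) = 0 := by linarith [h0.1, h1.1]
    rcases mul_eq_zero.1 this with h | h <;> linarith
  have e2 : δ * t = δ' * t' := by
    have : (δ * t - δ' * t') * (r / 2) = 0 := by linarith [h0.2, h1.2]
    rcases mul_eq_zero.1 this with h | h <;> linarith
  rw [e1, e2] at h0
  funext w
  rw [hT, hT', e1, e2, add_left_cancel h0.1, add_left_cancel h0.2]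

theorem eq_of_eventuallyEq_comp {X : Type*} [TopologicalSpace X] (hT : IsSignedScaling s t T)
    (hT' : IsSignedScaling s' t' T') {D : X → ℝ × ℝ} {p : X}
    (hD : Filter.map D (𝓝 p) = 𝓝 (D p)) (h : ∀ᶠ q in 𝓝 p, T (D q) = T' (D q)) : T = T' :=
  hT.eq_of_eventuallyEq hT' (z := D p) (by rw [← hD, Filter.eventually_map]; exact h)

end IsSignedScaling

/-! ### The developing map -/

namespace TransverseMeasuredFoliations

variable {X : Type*} [TopologicalSpace X] (F : TransverseMeasuredFoliations X)

open Classical in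
/-- The signed isometry that changes the chart `e` to the chart `e'` near `p`. -/
noncomputable def chartChange (e e' : F.charts) (p : X) : ℝ × ℝ → ℝ × ℝ :=
  if h : p ∈ e.1.source ∩ e'.1.source then
    (scalesCharts_iff.1 (F.compatible e e.2 e' e'.2 p h)).choose else id

theorem chartChange_isSignedScaling (e e' : F.charts) (p : X) :
    IsSignedScaling 1 1 (F.chartChange e e' p) := by
  unfold chartChange
  split_ifs with h
  · exact (scalesCharts_iff.1 (F.compatible e e.2 e' e'.2 p h)).choose_spec.1
  · exact IsSignedScaling.id

theorem eventually_chartChange {e e' : F.charts} {p : X} (h : p ∈ e.1.source ∩ e'.1.source) :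
    ∀ᶠ q in 𝓝 p, e'.1 q = F.chartChange e e' p (e.1 q) := by
  unfold chartChange
  rw [dif_pos h]
  exact (scalesCharts_iff.1 (F.compatible e e.2 e' e'.2 p h)).choose_spec.2

theorem chartChange_unique {e e' : F.charts} {p : X} (h : p ∈ e.1.source ∩ e'.1.source) {s t : ℝ}
    {T : ℝ × ℝ → ℝ × ℝ} (hT : IsSignedScaling s t T) (hT' : ∀ᶠ q in 𝓝 p, e'.1 q = T (e.1 q)) :
    F.chartChange e e' p = T := by
  refine (F.chartChange_isSignedScaling e e' p).eq_of_eventuallyEq_comp hT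
    (e.1.map_nhds_eq h.1) ?_
  filter_upwards [hT', F.eventually_chartChange h] with q h1 h2
  rw [← h1, h2]

theorem chartChange_self {e : F.charts} {p : X} (h : p ∈ e.1.source) :
    F.chartChange e e p = id :=
  F.chartChange_unique ⟨h, h⟩ IsSignedScaling.id (Filter.Eventually.of_forall fun _ => rfl)

theorem chartChange_comp {e e' e'' : F.charts} {p : X} (h : p ∈ e.1.source) (h' : p ∈ e'.1.source)
    (h'' : p ∈ e''.1.source) :
    F.chartChange e' e'' p ∘ F.chartChange e e' p = F.chartChange e e'' p := by
  refine (F.chartChange_unique ⟨h, h''⟩ ((F.chartChange_isSignedScaling e' e'' p).comp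
    (F.chartChange_isSignedScaling e e' p)) ?_).symm
  filter_upwards [F.eventually_chartChange ⟨h, h'⟩, F.eventually_chartChange ⟨h', h''⟩]
    with q h1 h2
  rw [h2, h1, Function.comp_apply]

/-- Local constancy is what makes the coordinate changes of `germBundle` continuous for the discrete
fibre. -/
theorem eventually_chartChange_eq {e e' : F.charts} {p : X}
    (h : p ∈ e.1.source ∩ e'.1.source) :
    ∀ᶠ q in 𝓝 p, F.chartChange e e' q = F.chartChange e e' p := by
  filter_upwards [(F.eventually_chartChange h).eventually_nhds,
    (e.1.open_source.inter e'.1.open_source).mem_nhds h] with q h1 h2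
  exact F.chartChange_unique h2 (F.chartChange_isSignedScaling e e' p) h1

/-- The signed isometries of the plane, with the discrete topology. -/
@[ext]
structure SignedIsometry : Type where
  toFun : ℝ × ℝ → ℝ × ℝ
  isSignedScaling : IsSignedScaling 1 1 toFun

instance : TopologicalSpace SignedIsometry := ⊥

instance : DiscreteTopology SignedIsometry := ⟨rfl⟩

/-- The bundle of germs of signed isometric changes of the foliation charts. -/
noncomputable def germBundle : FiberBundleCore F.charts X SignedIsometry where
  baseSet e := e.1.source
  isOpen_baseSet e := e.1.open_source
  indexAt p := ⟨(F.covers p).choose, (F.covers p).choose_spec.1⟩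
  mem_baseSet_at p := (F.covers p).choose_spec.2
  -- The point `g` over `p` in the chart `e` stands for the germ of `g ∘ e`, rewritten here in terms
  -- of `e'`.
  coordChange e e' p g := ⟨g.toFun ∘ F.chartChange e' e p, by
    simpa using g.2.comp (F.chartChange_isSignedScaling e' e p)⟩
  coordChange_self e p hp g := by
    apply SignedIsometry.ext
    simp [F.chartChange_self hp]
  continuousOn_coordChange e e' := by
    rintro ⟨p, g⟩ ⟨hp, -⟩
    refine ContinuousAt.continuousWithinAt ?_
    change Filter.Tendsto _ _ _
    rw [nhds_discrete SignedIsometry, Filter.tendsto_pure, nhds_prod_eq,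
      nhds_discrete SignedIsometry, Filter.prod_pure, Filter.eventually_map]
    filter_upwards [F.eventually_chartChange_eq ⟨hp.2, hp.1⟩] with q hq
    simp only [hq]
  coordChange_comp e e' e'' p hp g := by
    apply SignedIsometry.ext
    simp only [Function.comp_assoc, F.chartChange_comp hp.2 hp.1.2 hp.1.1]

/-- The developing map of a pair of transverse measured foliations along a map from a simply
connected space. -/
theorem exists_developingMap {A : Type*} [TopologicalSpace A] [SimplyConnectedSpace A]
    [LocallyPathConnectedSpace A] {π : A → X} (hπ : Continuous π) :
    ∃ D : A → ℝ × ℝ, ∀ q, ∃ e ∈ F.charts, π q ∈ e.source ∧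
      ∃ T, IsSignedScaling 1 1 T ∧ ∀ᶠ q' in 𝓝 q, D q' = T (e (π q')) := by
  have cov : IsCoveringMap F.germBundle.proj := FiberBundle.isCoveringMap
  obtain ⟨q₀⟩ : Nonempty A := inferInstance
  -- A lift of `π` to this covering is a continuous choice of germs; evaluating them gives the
  -- developing map.
  obtain ⟨S, ⟨-, hS⟩, -⟩ := cov.existsUnique_continuousMap_lifts ⟨π, hπ⟩ q₀
    (⟨π q₀, (⟨id, IsSignedScaling.id⟩ : SignedIsometry)⟩ : F.germBundle.TotalSpace) rfl
  have hproj : ∀ q, (S q).proj = π q := fun q => congrFun hS q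
  let e : A → F.charts := fun q => F.germBundle.indexAt (S q).proj
  have he : ∀ q, π q ∈ (e q).1.source := fun q => by
    rw [← hproj]; exact F.germBundle.mem_baseSet_at _
  let g : A → SignedIsometry := fun q => (S q).2
  refine ⟨fun q => (g q).1 ((e q).1 (π q)), fun q => ⟨e q, (e q).2, he q, ?_⟩⟩
  have hc : ContinuousAt (fun q' => (F.germBundle.localTriv (e q) (S q')).2) q :=
    continuousAt_snd.comp (((F.germBundle.localTriv (e q)).continuousAt
      ((F.germBundle.localTriv (e q)).mem_source.2
        (F.germBundle.mem_baseSet_at _))).comp S.continuous.continuousAt)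
  change Filter.Tendsto _ _ _ at hc
  rw [nhds_discrete SignedIsometry, Filter.tendsto_pure] at hc
  refine ⟨_, (F.germBundle.localTriv (e q) (S q)).2.2, ?_⟩
  filter_upwards [hc, hπ.continuousAt.eventually_mem ((e q).1.open_source.mem_nhds (he q))]
    with q' h1 h2
  rw [← h1]
  change (g q').1 ((e q').1 (π q')) = ((g q').1 ∘ F.chartChange (e q) (e q') (S q').proj) _
  rw [hproj, Function.comp_apply, ← (F.eventually_chartChange ⟨h2, he q'⟩).self_of_nhds]

end TransverseMeasuredFoliations

/-- `D` is given near each point by a foliation chart, up to a signed isometry. -/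
def TransverseMeasuredFoliations.IsDevelopingMap {X : Type*} [TopologicalSpace X]
    (F : TransverseMeasuredFoliations X) {A : Type*} [TopologicalSpace A] (π : A → X)
    (D : A → ℝ × ℝ) : Prop :=
  ∀ q, ∃ e ∈ F.charts, π q ∈ e.source ∧
    ∃ T, IsSignedScaling 1 1 T ∧ ∀ᶠ q' in 𝓝 q, D q' = T (e (π q'))

/-- A relation by signed scalings that holds locally holds globally. -/
theorem exists_isSignedScaling_of_locally {A : Type*} [TopologicalSpace A] [PreconnectedSpace A]
    [Nonempty A] {s t : ℝ} {D D' : A → ℝ × ℝ} (hD : IsLocalHomeomorph D)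
    (h : ∀ q, ∃ T, IsSignedScaling s t T ∧ ∀ᶠ q' in 𝓝 q, D' q' = T (D q')) :
    ∃ T, IsSignedScaling s t T ∧ ∀ q, D' q = T (D q) := by
  choose τ hτ hloc using h
  have hconst : IsLocallyConstant τ := by
    refine (IsLocallyConstant.iff_eventually_eq τ).2 fun q => ?_
    filter_upwards [(hloc q).eventually_nhds] with q' hq'
    refine (hτ q').eq_of_eventuallyEq_comp (hτ q) (hD.map_nhds_eq q') ?_
    filter_upwards [hq', hloc q'] with x h1 h2
    rw [← h1, h2]
  obtain ⟨q₀⟩ := ‹Nonempty A›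
  refine ⟨τ q₀, hτ q₀, fun q => ?_⟩
  rw [(hloc q).self_of_nhds, hconst.apply_eq_of_preconnectedSpace q q₀]

namespace TransverseMeasuredFoliations.IsDevelopingMap

variable {X : Type*} [TopologicalSpace X] {F : TransverseMeasuredFoliations X}
  {A : Type*} [TopologicalSpace A] {π : A → X} {D : A → ℝ × ℝ}

theorem isLocalHomeomorph (hD : F.IsDevelopingMap π D) (hπ : IsLocalHomeomorph π) :
    IsLocalHomeomorph D := by
  refine IsLocalHomeomorph.mk D fun q => ?_
  obtain ⟨e, -, hq, T, hT, hev⟩ := hD q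
  obtain ⟨φ, hφ, rfl⟩ := hπ q
  obtain ⟨g, hg⟩ := hT.exists_homeomorph one_ne_zero one_ne_zero
  obtain ⟨U, hU, hUo, hqU⟩ := eventually_nhds_iff.1 hev
  refine ⟨((φ.trans e).trans g.toOpenPartialHomeomorph).restrOpen U hUo, ?_, ?_⟩
  · simp [hφ, hq, hqU]
  · intro x hx
    have hxU : x ∈ U := by simp at hx; exact hx.2
    simp [hU x hxU, hg]

/-- A lift of a map that scales the transverse measures scales the developing map. -/
theorem exists_isSignedScaling_comp [PreconnectedSpace A] [Nonempty A]
    (hD : F.IsDevelopingMap π D) (hπ : IsLocalHomeomorph π) {s t : ℝ} {h : X → X}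
    (hh : ∀ e ∈ F.charts, ∀ e' ∈ F.charts, ∀ p ∈ e.source, h p ∈ e'.source →
      ScalesCharts s t h e e' p)
    {H : A → A} (hH : Continuous H) (hlift : ∀ q, π (H q) = h (π q)) :
    ∃ T, IsSignedScaling s t T ∧ ∀ q, D (H q) = T (D q) := by
  refine exists_isSignedScaling_of_locally (D' := fun q => D (H q)) (hD.isLocalHomeomorph hπ)
    fun q => ?_
  obtain ⟨e, he, hq, T, hT, hev⟩ := hD q
  obtain ⟨e', he', hq', T', hT', hev'⟩ := hD (H q)
  rw [hlift] at hq'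
  obtain ⟨S, hS, hSev⟩ := scalesCharts_iff.1 (hh e he e' he' _ hq hq')
  obtain ⟨R, hR, hRT, -⟩ := hT.exists_inverse one_ne_zero one_ne_zero
  refine ⟨T' ∘ S ∘ R, by simpa using hT'.comp (hS.comp hR), ?_⟩
  filter_upwards [hev, hH.continuousAt.eventually hev',
    hπ.continuous.continuousAt.eventually hSev] with x h1 h2 h3
  rw [h2, hlift, h3, h1, Function.comp_apply, Function.comp_apply, hRT]

theorem exists_isSignedScaling_deck [PreconnectedSpace A] [Nonempty A]
    (hD : F.IsDevelopingMap π D) (hπ : IsLocalHomeomorph π) {H : A → A} (hH : Continuous H)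
    (hlift : ∀ q, π (H q) = π q) :
    ∃ T, IsSignedScaling 1 1 T ∧ ∀ q, D (H q) = T (D q) :=
  hD.exists_isSignedScaling_comp hπ (h := id)
    (fun e he e' he' p hp hp' => F.compatible e he e' he' p ⟨hp, hp'⟩) hH hlift

end TransverseMeasuredFoliations.IsDevelopingMap

/-! ### The universal covering of the torus and lifts -/

/-- The integral points of the plane. -/
def latticePoint : (Fin 2 → ℤ) →+ ℝ × ℝ where
  toFun v := ((v 0 : ℝ), (v 1 : ℝ))
  map_zero' := by simp
  map_add' v w := by simp

theorem latticePoint_apply (v : Fin 2 → ℤ) : latticePoint v = ((v 0 : ℝ), (v 1 : ℝ)) := rfl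

theorem latticePoint_injective : Function.Injective latticePoint := by
  intro v w h
  simp only [latticePoint_apply, Prod.mk.injEq, Int.cast_inj] at h
  ext i
  fin_cases i
  · exact h.1
  · exact h.2

/-- The universal covering of the torus. -/
def torusProj : ℝ × ℝ →+ Torus2 :=
  (QuotientAddGroup.mk' _).prodMap (QuotientAddGroup.mk' _)

theorem torusProj_apply (p : ℝ × ℝ) :
    torusProj p = ((p.1 : UnitAddCircle), (p.2 : UnitAddCircle)) := rfl

theorem torusProj_eq_zero_iff {p : ℝ × ℝ} : torusProj p = 0 ↔ ∃ v, p = latticePoint v := by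
  rw [torusProj_apply, Prod.mk_eq_zero, AddCircle.coe_eq_zero_iff, AddCircle.coe_eq_zero_iff]
  constructor
  · rintro ⟨⟨m, hm⟩, n, hn⟩
    exact ⟨![m, n], by ext <;> simp [latticePoint_apply, ← hm, ← hn]⟩
  · rintro ⟨v, rfl⟩
    exact ⟨⟨v 0, by simp [latticePoint_apply]⟩, v 1, by simp [latticePoint_apply]⟩

theorem torusProj_eq_iff {p q : ℝ × ℝ} :
    torusProj p = torusProj q ↔ ∃ v, p = q + latticePoint v := by
  rw [← sub_eq_zero, ← map_sub, torusProj_eq_zero_iff]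
  simp only [sub_eq_iff_eq_add']

@[simp] theorem torusProj_latticePoint (v : Fin 2 → ℤ) : torusProj (latticePoint v) = 0 :=
  torusProj_eq_zero_iff.2 ⟨v, rfl⟩

theorem isDiscrete_ker_torusProj : IsDiscrete (torusProj.ker : Set (ℝ × ℝ)) := by
  refine ⟨discreteTopology_iff_isOpen_singleton.2 fun ⟨x, hx⟩ => ?_⟩
  refine ⟨Metric.ball x 1, Metric.isOpen_ball, ?_⟩
  ext ⟨y, hy⟩
  simp only [Set.mem_preimage, Set.mem_singleton_iff, Subtype.mk.injEq]
  constructor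
  · intro h
    obtain ⟨v, hv⟩ := torusProj_eq_iff.1 (hy.trans hx.symm : torusProj y = torusProj x)
    rw [mem_ball_iff_norm, hv, add_sub_cancel_left, latticePoint_apply, Prod.norm_def,
      max_lt_iff] at h
    simp only [Real.norm_eq_abs] at h
    have h0 : v 0 = 0 := Int.abs_lt_one_iff.1 (by exact_mod_cast h.1)
    have h1 : v 1 = 0 := Int.abs_lt_one_iff.1 (by exact_mod_cast h.2)
    rw [hv, latticePoint_apply, h0, h1]
    simp
  · rintro rfl
    exact Metric.mem_ball_self one_pos

theorem isOpenQuotientMap_torusProj : IsOpenQuotientMap torusProj :=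
  QuotientAddGroup.isOpenQuotientMap_mk.prodMap QuotientAddGroup.isOpenQuotientMap_mk

theorem isCoveringMap_torusProj : IsCoveringMap torusProj :=
  (isOpenQuotientMap_torusProj.isQuotientMap.isAddQuotientCoveringMap_of_isDiscrete_ker_addMonoidHom
    isDiscrete_ker_torusProj).isCoveringMap

theorem continuous_torusProj : Continuous torusProj := isCoveringMap_torusProj.continuous

/-- Two maps to the plane with the same projection to the torus differ by a lattice point. -/
theorem exists_eq_add_latticePoint {A : Type*} [TopologicalSpace A] [PreconnectedSpace A]
    [Nonempty A] {F G : A → ℝ × ℝ} (hF : Continuous F) (hG : Continuous G)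
    (h : ∀ p, torusProj (F p) = torusProj (G p)) : ∃ v, ∀ p, F p = G p + latticePoint v := by
  obtain ⟨p₀⟩ := ‹Nonempty A›
  obtain ⟨v, hv⟩ := torusProj_eq_iff.1 (h p₀)
  refine ⟨v, fun p => ?_⟩
  have := isCoveringMap_torusProj.const_of_comp (hF.sub hG)
    (fun a a' => by simp [map_sub, h]) p p₀
  change F p - G p = F p₀ - G p₀ at this
  rw [hv, add_sub_cancel_left] at this
  rw [← this, add_sub_cancel]

theorem exists_continuous_lift (f : C(Torus2, Torus2)) {p q : ℝ × ℝ}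
    (h : torusProj q = f (torusProj p)) :
    ∃ F : C(ℝ × ℝ, ℝ × ℝ), F p = q ∧ ∀ x, torusProj (F x) = f (torusProj x) := by
  obtain ⟨F, ⟨h1, h2⟩, -⟩ := isCoveringMap_torusProj.existsUnique_continuousMap_lifts
    (f.comp ⟨torusProj, continuous_torusProj⟩) p q h
  exact ⟨F, h1, fun x => congrFun h2 x⟩

theorem exists_homeomorph_lift (f : Torus2 ≃ₜ Torus2) :
    ∃ F : ℝ × ℝ ≃ₜ ℝ × ℝ, ∀ p, torusProj (F p) = f (torusProj p) := by
  obtain ⟨q, hq⟩ := isOpenQuotientMap_torusProj.surjective (f (torusProj 0))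
  obtain ⟨F, hF0, hF⟩ := exists_continuous_lift (f : C(Torus2, Torus2)) hq
  obtain ⟨G, hG0, hG⟩ := exists_continuous_lift (f.symm : C(Torus2, Torus2)) (p := q) (q := 0)
    (by rw [hq]; simp)
  have key : ∀ {K L : C(ℝ × ℝ, ℝ × ℝ)} (x : ℝ × ℝ), K (L x) = x →
      (∀ y, torusProj (K (L y)) = torusProj y) → ∀ y, K (L y) = y := fun {K L} x hx h y =>
    congrFun (isCoveringMap_torusProj.eq_of_comp_eq (g₁ := K ∘ L) (g₂ := id)
      (K.continuous.comp L.continuous) continuous_id (funext h) x hx) y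
  refine ⟨⟨⟨F, G, ?_, ?_⟩, F.continuous, G.continuous⟩, hF⟩
  · exact key 0 (by rw [hF0, hG0]) fun y => by rw [hG, hF]; simp
  · exact key q (by rw [hG0, hF0]) fun y => by rw [hF, hG]; simp

/-- The action of a lift on the lattice of deck translations. -/
theorem exists_matrix_of_lift {f : Torus2 → Torus2} {F : ℝ × ℝ → ℝ × ℝ} (hF : Continuous F)
    (h : ∀ p, torusProj (F p) = f (torusProj p)) :
    ∃ A : Matrix (Fin 2) (Fin 2) ℤ,
      ∀ p v, F (p + latticePoint v) = F p + latticePoint (A.mulVec v) := by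
  have h1 : ∀ v, ∃ w, ∀ p, F (p + latticePoint v) = F p + latticePoint w := fun v =>
    exists_eq_add_latticePoint (F := fun p => F (p + latticePoint v)) (by fun_prop) hF
      fun p => by rw [h, h]; simp
  choose a ha using h1
  have hadd : ∀ v w, a (v + w) = a v + a w := fun v w => latticePoint_injective (by
    have := ha (v + w) 0
    rw [map_add, ← add_assoc, ha w, ha v, add_assoc] at this
    rw [map_add]
    exact (add_left_cancel this).symm)
  refine ⟨LinearMap.toMatrix' (AddMonoidHom.mk' a hadd).toIntLinearMap, fun p v => ?_⟩
  rw [LinearMap.toMatrix'_mulVec]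
  exact ha v p

/-! ### Deck translations and the correction of a lift -/

/-- The deck translation of the plane by an integral vector. -/
noncomputable def deck (v : Fin 2 → ℤ) : ℝ × ℝ ≃ₜ ℝ × ℝ := Homeomorph.addRight (latticePoint v)

@[simp] theorem deck_apply (v : Fin 2 → ℤ) (p : ℝ × ℝ) : deck v p = p + latticePoint v := rfl

theorem deck_add (v w : Fin 2 → ℤ) : deck (v + w) = deck v * deck w := by
  ext1 p
  simp [add_assoc, add_comm (latticePoint v)]

theorem deck_nsmul (k : ℕ) (v : Fin 2 → ℤ) : deck (k • v) = deck v ^ k := by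
  induction k with
  | zero => ext1 p; simp
  | succ k ih => rw [succ_nsmul, deck_add, ih, pow_succ]

theorem pow_lift {f : Torus2 ≃ₜ Torus2} {F : ℝ × ℝ ≃ₜ ℝ × ℝ}
    (h : ∀ p, torusProj (F p) = f (torusProj p)) (k : ℕ) (p : ℝ × ℝ) :
    torusProj ((F ^ k) p) = (f ^ k) (torusProj p) := by
  induction k generalizing p with
  | zero => simp
  | succ k ih => rw [pow_succ, pow_succ, Homeomorph.mul_apply, ih, h, Homeomorph.mul_apply]

/-- A lift that commutes with the deck translations and satisfies the relation of `BS(1, n)` up to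
a deck translation can be corrected, after passing to a power. -/
theorem exists_corrected_lift {H G : ℝ × ℝ ≃ₜ ℝ × ℝ} {B : Matrix (Fin 2) (Fin 2) ℤ} {n : ℕ}
    (hB : ∀ v, H * deck v = deck (B.mulVec v) * H) (hG : ∀ v, Commute G (deck v))
    (hdet : ((n : Matrix (Fin 2) (Fin 2) ℤ) - B).det ≠ 0) {v : Fin 2 → ℤ}
    (h : H * G = deck v * G ^ n * H) :
    ∃ k : ℕ, 0 < k ∧ ∃ w, H * (deck w * G ^ k) = (deck w * G ^ k) ^ n * H := by
  set δ := ((n : Matrix (Fin 2) (Fin 2) ℤ) - B).det with hδ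
  -- The correction requires `(n - B) w = k v`. The adjugate solves it for `k = δ`; the extra factor
  -- `δ` makes `k = δ ^ 2` positive whatever the sign of `δ`.
  set w := δ • ((n : Matrix (Fin 2) (Fin 2) ℤ) - B).adjugate.mulVec v with hw
  refine ⟨δ.natAbs ^ 2, by positivity, w, ?_⟩
  have hk : ((δ.natAbs ^ 2 : ℕ) : ℤ) = δ ^ 2 := by simp
  set k := δ.natAbs ^ 2
  have hsum : B.mulVec w + k • v = n • w := by
    have : ((n : Matrix (Fin 2) (Fin 2) ℤ) - B).mulVec w = k • v := by
      rw [hw, Matrix.mulVec_smul, Matrix.mulVec_mulVec, Matrix.mul_adjugate, ← hδ,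
        Matrix.smul_mulVec, Matrix.one_mulVec, smul_smul, ← natCast_zsmul, hk, sq]
    rw [Matrix.sub_mulVec] at this
    rw [← this, add_sub_cancel, Matrix.natCast_mulVec]
    ext i; simp
  have h1 : H * G ^ k = deck (k • v) * G ^ (n * k) * H := by
    have : SemiconjBy H G (deck v * G ^ n) := h
    have h2 := this.pow_right k
    rw [(((hG v).symm).pow_right n).mul_pow, ← deck_nsmul, ← pow_mul] at h2
    exact h2
  rw [(((hG w).symm).pow_right k).mul_pow, ← deck_nsmul, ← pow_mul, ← mul_assoc, hB, mul_assoc, h1,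
    ← hsum, deck_add, mul_comm k n]
  simp only [mul_assoc]

/-! ### Two-by-two matrices conjugate to their powers -/

namespace Matrix

variable {R : Type*} [CommRing R] {M : Matrix (Fin 2) (Fin 2) R}

theorem pow_fin_two_of_upperTriangular (h : M 1 0 = 0) (k : ℕ) :
    (M ^ k) 1 0 = 0 ∧ (M ^ k) 0 0 = M 0 0 ^ k ∧ (M ^ k) 1 1 = M 1 1 ^ k := by
  induction k with
  | zero => simp
  | succ k ih => simp [pow_succ, mul_apply, Fin.sum_univ_two, ih, h]

theorem pow_fin_two_of_lowerTriangular (h : M 0 1 = 0) (k : ℕ) :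
    (M ^ k) 0 1 = 0 ∧ (M ^ k) 0 0 = M 0 0 ^ k ∧ (M ^ k) 1 1 = M 1 1 ^ k := by
  have := pow_fin_two_of_upperTriangular (M := Mᵀ) h k
  simpa [← transpose_pow] using this

theorem pow_fin_two_corner (h : M 1 0 = 0) (hd : M 1 1 = M 0 0) (k : ℕ) :
    M 0 0 * (M ^ k) 0 1 = k * M 0 0 ^ k * M 0 1 := by
  induction k with
  | zero => simp
  | succ k ih =>
    rw [pow_succ, mul_apply, Fin.sum_univ_two, (pow_fin_two_of_upperTriangular h k).2.1, hd]
    push_cast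
    linear_combination M 0 0 * ih

theorem pow_fin_two_corner' (h : M 0 1 = 0) (hd : M 1 1 = M 0 0) (k : ℕ) :
    M 0 0 * (M ^ k) 1 0 = k * M 0 0 ^ k * M 1 0 := by
  have := pow_fin_two_corner (M := Mᵀ) h hd k
  simpa [← transpose_pow] using this

/-- A matrix that a hyperbolic diagonal matrix conjugates to its `n`-th power is an involution, if
the expansion of the diagonal matrix is larger than `n`. -/
theorem sq_eq_one_of_diagonal_mul_eq {M : Matrix (Fin 2) (Fin 2) ℝ} {n : ℕ} (hn : 2 ≤ n)
    {lam p q : ℝ} (hlam : n < lam) (hp : |p| = lam) (hq : |q| = lam⁻¹) (hM : M.det ≠ 0)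
    (h : diagonal ![p, q] * M = M ^ n * diagonal ![p, q]) : M ^ 2 = 1 := by
  have hn' : (2 : ℝ) ≤ n := by exact_mod_cast hn
  have hlam1 : 1 < lam := by linarith
  have hlam0 : 0 < lam := by linarith
  have hinv : lam⁻¹ < 1 := inv_lt_one_of_one_lt₀ hlam1
  have hinv0 : 0 < lam⁻¹ := inv_pos.2 hlam0
  have hp0 : p ≠ 0 := by rw [← abs_pos, hp]; exact hlam0
  have hq0 : q ≠ 0 := by rw [← abs_pos, hq]; exact hinv0
  have entry : ∀ i j, ![p, q] i * M i j = (M ^ n) i j * ![p, q] j := fun i j => by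
    have := congrFun (congrFun h i) j
    rwa [diagonal_mul, mul_diagonal] at this
  have e00 : p * M 0 0 = (M ^ n) 0 0 * p := entry 0 0
  have e01 : p * M 0 1 = (M ^ n) 0 1 * q := entry 0 1
  have e10 : q * M 1 0 = (M ^ n) 1 0 * p := entry 1 0
  have e11 : q * M 1 1 = (M ^ n) 1 1 * q := entry 1 1
  have hcomm : (M ^ n) 0 1 * M 1 0 = M 0 1 * (M ^ n) 1 0 := by
    have := congrFun (congrFun (((Commute.refl M).pow_left n).eq) 0) 0
    simp only [mul_apply, Fin.sum_univ_two] at this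
    linarith [mul_comm (M 0 0) ((M ^ n) 0 0)]
  have hpq : p ^ 2 ≠ q ^ 2 := by
    rw [Ne, sq_eq_sq_iff_abs_eq_abs, hp, hq]
    intro h; linarith
  -- Comparing the off-diagonal entries of the relation with the commutation of `M` and `M ^ n`
  -- shows that `M` is triangular.
  have hbc : M 0 1 * M 1 0 = 0 := by
    have : (p ^ 2 - q ^ 2) * (M 0 1 * M 1 0) = 0 := by
      linear_combination (p * M 1 0) * e01 - (q * M 0 1) * e10 + p * q * hcomm
    exact (mul_eq_zero.1 this).resolve_left (sub_ne_zero.2 hpq)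
  have hdet : M 0 0 * M 1 1 ≠ 0 := by
    rw [det_fin_two, hbc, sub_zero] at hM; exact hM
  have unit : ∀ a : ℝ, a ≠ 0 → a ^ n = a → a = 1 ∨ a = -1 := fun a ha h => by
    have h1 : a ^ (n - 1) = 1 := by
      rw [← Nat.sub_add_cancel (by omega : 1 ≤ n), pow_succ] at h
      exact mul_right_cancel₀ ha (by rw [h, one_mul])
    have h2 : |a| ^ (n - 1) = 1 := by rw [← abs_pow, h1, abs_one]
    rwa [pow_eq_one_iff_of_nonneg (abs_nonneg a) (by omega), abs_eq zero_le_one] at h2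
  -- The diagonal entries are `±1`. If they differ, the trace is zero and `M ^ 2 = 1` already; if
  -- they agree, the off-diagonal entries must vanish.
  have finish : (M ^ n) 0 0 = M 0 0 ^ n → (M ^ n) 1 1 = M 1 1 ^ n →
      (M 1 1 = M 0 0 → M 0 1 = 0 ∧ M 1 0 = 0) → M ^ 2 = 1 := by
    intro h0 h1 hoff
    have ha := unit (M 0 0) (left_ne_zero_of_mul hdet)
      (by rw [← h0]; exact mul_right_cancel₀ hp0 (by rw [← e00, mul_comm]))
    have hd := unit (M 1 1) (right_ne_zero_of_mul hdet)
      (by rw [← h1]; exact mul_right_cancel₀ hq0 (by rw [← e11, mul_comm]))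
    have hsum : M 0 1 * (M 0 0 + M 1 1) = 0 ∧ M 1 0 * (M 0 0 + M 1 1) = 0 := by
      by_cases heq : M 1 1 = M 0 0
      · simp [hoff heq]
      · have : M 0 0 + M 1 1 = 0 := by
          rcases ha with ha | ha <;> rcases hd with hd | hd <;> simp [ha, hd] at heq ⊢
        simp [this]
    have ha2 : M 0 0 * M 0 0 = 1 := by rcases ha with h | h <;> simp [h]
    have hd2 : M 1 1 * M 1 1 = 1 := by rcases hd with h | h <;> simp [h]
    ext i j
    rw [sq, mul_apply, Fin.sum_univ_two]
    fin_cases i <;> fin_cases j <;> simp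
    · linarith
    · linarith [hsum.1]
    · linarith [hsum.2]
    · linarith
  have abs_unit : ∀ a : ℝ, a = 1 ∨ a = -1 → |a| = 1 := by rintro a (rfl | rfl) <;> simp
  rcases mul_eq_zero.1 hbc with hb | hc
  · obtain ⟨-, h0, h1⟩ := pow_fin_two_of_lowerTriangular hb n
    refine finish h0 h1 fun hd => ⟨hb, ?_⟩
    have hc := pow_fin_two_corner' hb hd n
    have ha0 := left_ne_zero_of_mul hdet
    rw [← h0, (mul_right_cancel₀ hp0 (by rw [← e00, mul_comm]) : (M ^ n) 0 0 = M 0 0)] at hc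
    -- The corner of a unipotent matrix up to sign grows linearly, which would force `q = n p`,
    -- against the absolute values.
    have hc' : (M ^ n) 1 0 = n * M 1 0 := mul_left_cancel₀ ha0 (by rw [hc]; ring)
    rw [hc'] at e10
    have : (q - n * p) * M 1 0 = 0 := by linear_combination e10
    refine (mul_eq_zero.1 this).resolve_left fun h => ?_
    have := congrArg abs (sub_eq_zero.1 h)
    rw [abs_mul, hp, hq, abs_of_pos (by linarith : (0 : ℝ) < n)] at this
    nlinarith
  · obtain ⟨-, h0, h1⟩ := pow_fin_two_of_upperTriangular hc n
    refine finish h0 h1 fun hd => ⟨?_, hc⟩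
    have hb := pow_fin_two_corner hc hd n
    have ha0 := left_ne_zero_of_mul hdet
    rw [← h0, (mul_right_cancel₀ hp0 (by rw [← e00, mul_comm]) : (M ^ n) 0 0 = M 0 0)] at hb
    have hb' : (M ^ n) 0 1 = n * M 0 1 := mul_left_cancel₀ ha0 (by rw [hb]; ring)
    rw [hb'] at e01
    have : (p - n * q) * M 0 1 = 0 := by linear_combination e01
    refine (mul_eq_zero.1 this).resolve_left fun h => ?_
    have := congrArg abs (sub_eq_zero.1 h)
    rw [abs_mul, hp, hq, abs_of_pos (by linarith : (0 : ℝ) < n)] at this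
    nlinarith

end Matrix

/-! ### Rigidity of maps with bounded displacement -/

/-- Any upper bound improves by the factor `r`, so iteration pushes it to zero. -/
theorem eq_zero_of_forall_le_mul {A : Type*} {φ : A → ℝ} (hφ : ∀ a, 0 ≤ φ a) {r : ℝ} (hr0 : 0 ≤ r)
    (hr : r < 1) (hb : ∃ M, ∀ a, φ a ≤ M)
    (h : ∀ M, (∀ a, φ a ≤ M) → ∀ a, φ a ≤ r * M) (a : A) : φ a = 0 := by
  obtain ⟨M, hM⟩ := hb
  have hk : ∀ k : ℕ, ∀ a, φ a ≤ r ^ k * M := by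
    intro k
    induction k with
    | zero => simpa using hM
    | succ k ih => rw [pow_succ', mul_assoc]; exact h _ ih
  have hlim := (tendsto_pow_atTop_nhds_zero_of_lt_one hr0 hr).mul_const M
  rw [zero_mul] at hlim
  exact le_antisymm (ge_of_tendsto' hlim fun k => hk k a) (hφ a)

theorem strictMono_of_bounded_displacement {φ : ℝ → ℝ} (hc : Continuous φ)
    (hi : Function.Injective φ) {M : ℝ} (hM : ∀ y, |φ y - y| ≤ M) : StrictMono φ := by
  refine (hc.strictMono_of_inj hi).resolve_right fun h => ?_
  have hM0 : 0 ≤ M := (abs_nonneg _).trans (hM 0)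
  have h1 := h (by linarith : (0 : ℝ) < 2 * M + 1)
  have h2 := (abs_le.1 (hM 0)).2
  have h3 := (abs_le.1 (hM (2 * M + 1))).1
  linarith

/-- The orbit of a point under a monotone map of the line never turns back. -/
theorem Monotone.abs_sub_le_abs_iterate_sub {φ : ℝ → ℝ} (hφ : Monotone φ) {n : ℕ} (hn : n ≠ 0)
    (y : ℝ) : |φ y - y| ≤ |φ^[n] y - y| := by
  rcases le_total y (φ y) with h | h
  · have h1 : φ^[1] y ≤ φ^[n] y := hφ.monotone_iterate_of_le_map h (by omega)
    rw [Function.iterate_one] at h1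
    rw [abs_of_nonneg (by linarith), abs_of_nonneg (by linarith)]
    linarith
  · have h1 : φ^[n] y ≤ φ^[1] y := hφ.antitone_iterate_of_map_le h (by omega)
    rw [Function.iterate_one] at h1
    rw [abs_of_nonpos (by linarith), abs_of_nonpos (by linarith)]
    linarith

/-- A homeomorphism of the plane at bounded distance from the identity, conjugated to its `n`-th
power by a map that stretches the first coordinate by more than `n` and contracts the second, is the
identity. -/
theorem eq_self_of_isSignedScaling_conj {n : ℕ} (hn : 1 ≤ n) {lam : ℝ} (hlam : n < lam)
    {T : ℝ × ℝ → ℝ × ℝ} (hT : IsSignedScaling lam lam⁻¹ T) {F : ℝ × ℝ ≃ₜ ℝ × ℝ}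
    (hF : ∀ z, T (F z) = (F ^ n) (T z)) {M₀ : ℝ} (hM₀ : ∀ z, ‖F z - z‖ ≤ M₀) (z : ℝ × ℝ) :
    F z = z := by
  have hn' : (1 : ℝ) ≤ n := by exact_mod_cast hn
  have hlam0 : 0 < lam := by linarith
  have hlam1 : 1 < lam := by linarith
  have hsurj : Function.Surjective T := by
    obtain ⟨T', -, -, h⟩ := hT.exists_inverse hlam0.ne' (inv_pos.2 hlam0).ne'
    exact fun z => ⟨_, h z⟩
  have hT1 : ∀ z w, |(T z).1 - (T w).1| = lam * |z.1 - w.1| := by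
    obtain ⟨ε, δ, c, d, hε, -, h⟩ := hT
    intro z w
    have : (T z).1 - (T w).1 = ε * (lam * (z.1 - w.1)) := by rw [h, h]; ring
    rw [this, abs_mul, abs_mul, abs_of_pos hlam0]
    rcases hε with rfl | rfl <;> simp
  have hT2 : ∀ z w, |(T z).2 - (T w).2| = lam⁻¹ * |z.2 - w.2| := by
    obtain ⟨ε, δ, c, d, -, hδ, h⟩ := hT
    intro z w
    have : (T z).2 - (T w).2 = δ * (lam⁻¹ * (z.2 - w.2)) := by rw [h, h]; ring
    rw [this, abs_mul, abs_mul, abs_of_pos (inv_pos.2 hlam0)]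
    rcases hδ with rfl | rfl <;> simp
  have hpow : ∀ M, (∀ z, |(F z).1 - z.1| ≤ M) → ∀ (k : ℕ) z, |((F ^ k) z).1 - z.1| ≤ k * M := by
    intro M hM k
    induction k with
    | zero => simp
    | succ k ih =>
      intro z
      rw [pow_succ', Homeomorph.mul_apply]
      push_cast
      calc _ ≤ _ := abs_sub_le _ ((F ^ k) z).1 _
        _ ≤ M + k * M := add_le_add (hM _) (ih z)
        _ = _ := by ring
  -- A bound `M` on the horizontal displacement gives `n * M` for `F ^ n`; pulling back by `T` gives
  -- `(n / lam) * M`.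
  have hx : ∀ z, (F z).1 = z.1 := fun z => by
    rw [← sub_eq_zero, ← abs_eq_zero]
    refine eq_zero_of_forall_le_mul (φ := fun z => |(F z).1 - z.1|) (fun _ => abs_nonneg _)
      (r := n / lam) (by positivity) ((div_lt_one hlam0).2 hlam)
      ⟨M₀, fun z => (norm_fst_le (F z - z)).trans (hM₀ z)⟩ (fun M hM z => ?_) z
    have := hpow M hM n (T z)
    rw [← hF, hT1] at this
    rw [div_mul_eq_mul_div, le_div_iff₀ hlam0]
    linarith
  have hiter : ∀ (k : ℕ) z, (F ^ k) z = (z.1, (fun y => (F (z.1, y)).2)^[k] z.2) := by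
    intro k
    induction k with
    | zero => simp
    | succ k ih =>
      intro z
      rw [pow_succ, Homeomorph.mul_apply, ih, hx, Function.iterate_succ_apply]
  have hmono : ∀ x, StrictMono fun y => (F (x, y)).2 := fun x =>
    strictMono_of_bounded_displacement (by fun_prop)
      (fun y y' h => (Prod.mk.inj (F.injective (a₁ := (x, y)) (a₂ := (x, y'))
        (Prod.ext (by rw [hx, hx]) h))).2)
      (M := M₀) fun y => (norm_snd_le (F (x, y) - (x, y))).trans (hM₀ _)
  refine Prod.ext (hx z) ?_
  rw [← sub_eq_zero, ← abs_eq_zero]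
  refine eq_zero_of_forall_le_mul (φ := fun z => |(F z).2 - z.2|) (fun _ => abs_nonneg _)
    (r := lam⁻¹) (by positivity) (inv_lt_one_of_one_lt₀ hlam1)
    ⟨M₀, fun z => (norm_snd_le (F z - z)).trans (hM₀ z)⟩ (fun M hM z => ?_) z
  -- Vertically the estimate runs forward: the displacement of `F` at `T w` is at most that of `F ^
  -- n`, which is `lam⁻¹` times that of `F` at `w`.
  obtain ⟨w, rfl⟩ := hsurj z
  refine ((hmono (T w).1).monotone.abs_sub_le_abs_iterate_sub (by omega : n ≠ 0) _).trans ?_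
  have : ((F ^ n) (T w)).2 = (fun y => (F ((T w).1, y)).2)^[n] (T w).2 := by rw [hiter]
  rw [← this, ← hF, hT2]
  exact mul_le_mul_of_nonneg_left (hM w) (by positivity)

/-! ### Periods and properness of the developing map -/

/-- The vector of the plane with the given coordinates. -/
noncomputable def planeVector : (Fin 2 → ℝ) ≃L[ℝ] ℝ × ℝ := ContinuousLinearEquiv.finTwoArrow ℝ ℝ

theorem planeVector_apply (u : Fin 2 → ℝ) : planeVector u = (u 0, u 1) := rfl

theorem latticePoint_eq_planeVector (v : Fin 2 → ℤ) :
    latticePoint v = planeVector fun i => (v i : ℝ) := rfl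

theorem exists_bound_of_periodic {E : Type*} [NormedAddCommGroup E] {u : ℝ × ℝ → E}
    (hu : Continuous u) (hper : ∀ p v, u (p + latticePoint (2 • v)) = u p) :
    ∃ M, ∀ p, ‖u p‖ ≤ M := by
  obtain ⟨M, hM⟩ := (isCompact_Icc (a := ((0 : ℝ), (0 : ℝ))) (b := (2, 2))).exists_bound_of_continuousOn
    hu.continuousOn
  refine ⟨M, fun p => ?_⟩
  have key : ∀ x : ℝ, 0 ≤ x - 2 * ⌊x / 2⌋ ∧ x - 2 * ⌊x / 2⌋ ≤ 2 := fun x => by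
    have h1 := Int.floor_le (x / 2)
    have h2 := (Int.lt_floor_add_one (x / 2)).le
    constructor <;> linarith
  have hp : p = (p.1 - 2 * ⌊p.1 / 2⌋, p.2 - 2 * ⌊p.2 / 2⌋)
      + latticePoint (2 • ![⌊p.1 / 2⌋, ⌊p.2 / 2⌋]) := by
    ext <;> simp [latticePoint_apply]
  rw [hp, hper]
  exact hM _ ⟨⟨(key _).1, (key _).1⟩, ⟨(key _).2, (key _).2⟩⟩

/-- A bounded function that a bijection rescales is constant. -/
theorem eq_of_bounded_of_comp_eq {A : Type*} {u : A → ℝ} {H : A → A} (hH : Function.Surjective H)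
    {s c : ℝ} (hs : |s| ≠ 1) (h : ∀ a, u (H a) = s * u a + c) {M : ℝ} (hM : ∀ a, |u a| ≤ M)
    (a b : A) : u a = u b := by
  have hb : ∃ M, ∀ z : A × A, |u z.1 - u z.2| ≤ M :=
    ⟨M + M, fun z => (abs_sub _ _).trans (add_le_add (hM _) (hM _))⟩
  have hd : ∀ a b, |u (H a) - u (H b)| = |s| * |u a - u b| := fun a b => by
    rw [h, h, ← abs_mul]; congr 1; ring
  rw [← sub_eq_zero, ← abs_eq_zero]
  rcases lt_or_gt_of_ne hs with hs | hs
  · refine eq_zero_of_forall_le_mul (φ := fun z : A × A => |u z.1 - u z.2|)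
      (fun _ => abs_nonneg _) (abs_nonneg s) hs hb (fun M hM z => ?_) (a, b)
    obtain ⟨x, hx⟩ := hH z.1
    obtain ⟨y, hy⟩ := hH z.2
    rw [← hx, ← hy, hd]
    exact mul_le_mul_of_nonneg_left (hM (x, y)) (abs_nonneg s)
  · have hs0 : 0 < |s| := by linarith
    refine eq_zero_of_forall_le_mul (φ := fun z : A × A => |u z.1 - u z.2|)
      (fun _ => abs_nonneg _) (inv_nonneg.2 (abs_nonneg s)) (inv_lt_one_of_one_lt₀ hs) hb
      (fun M hM z => ?_) (a, b)
    have := hM (H z.1, H z.2)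
    rw [hd] at this
    rwa [inv_mul_eq_div, le_div_iff₀ hs0, mul_comm]

theorem IsLocalHomeomorph.not_forall_fst_eq {A : Type*} [TopologicalSpace A] [Nonempty A]
    {D : A → ℝ × ℝ} (hD : IsLocalHomeomorph D) (a : ℝ) : ¬ ∀ q, (D q).1 = a := by
  intro h
  obtain ⟨q⟩ := ‹Nonempty A›
  -- The degenerate factor `0` is allowed in `IsSignedScaling`, so the projection to a vertical line
  -- can be compared with the identity.
  have hT : IsSignedScaling 0 1 fun z => (a, z.2) :=
    ⟨1, 1, a, 0, .inl rfl, .inl rfl, fun z => by simp⟩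
  have := IsSignedScaling.id.eq_of_eventuallyEq_comp hT (hD.map_nhds_eq q)
    (Filter.Eventually.of_forall fun q' => by rw [← h q']; rfl)
  simpa using congrFun this (a + 1, 0)

theorem IsLocalHomeomorph.not_forall_snd_eq {A : Type*} [TopologicalSpace A] [Nonempty A]
    {D : A → ℝ × ℝ} (hD : IsLocalHomeomorph D) (a : ℝ) : ¬ ∀ q, (D q).2 = a :=
  ((Homeomorph.prodComm ℝ ℝ).isLocalHomeomorph.comp hD).not_forall_fst_eq a

/-- A proper local homeomorphism to a simply connected space is a homeomorphism. -/
theorem IsLocalHomeomorph.exists_homeomorph_of_isProperMap {E : Type*} [TopologicalSpace E]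
    [T2Space E] [PreconnectedSpace E] [Nonempty E] {B : Type*} [TopologicalSpace B] [T1Space B]
    [SimplyConnectedSpace B] [LocallyPathConnectedSpace B] {D : E → B}
    (hD : IsLocalHomeomorph D) (hp : IsProperMap D) : ∃ e : E ≃ₜ B, ∀ q, e q = D q := by
  have cov : IsCoveringMap D := by
    rw [isCoveringMap_iff_isCoveringMapOn_univ]
    refine hp.isClosedMap.isCoveringMapOn_of_isLocalHomeomorphOn (fun x _ => ?_)
      (isLocalHomeomorph_iff_isLocalHomeomorphOn_univ.1 hD)
    refine (hp.isCompact_preimage isCompact_singleton).finite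
      (IsDiscrete.of_openPartialHomeomorph D subset_rfl fun e _ => ?_)
    obtain ⟨φ, hφ, h⟩ := hD e
    exact ⟨φ, hφ, h.symm⟩
  obtain ⟨q₀⟩ := ‹Nonempty E›
  obtain ⟨S, ⟨h0, hS⟩, -⟩ := cov.existsUnique_continuousMap_lifts (ContinuousMap.id B) (D q₀) q₀ rfl
  have hS' : ∀ b, D (S b) = b := fun b => congrFun hS b
  have hinv := cov.eq_of_comp_eq (g₁ := S ∘ D) (g₂ := id) (S.continuous.comp cov.continuous)
    continuous_id (funext fun q => hS' (D q)) q₀ h0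
  exact ⟨⟨⟨D, S, congrFun hinv, hS'⟩, cov.continuous, S.continuous⟩, fun _ => rfl⟩

/-- The matrix of periods of a developing map. -/
theorem exists_periodMatrix {F : TransverseMeasuredFoliations Torus2} {D : ℝ × ℝ → ℝ × ℝ}
    (hD : F.IsDevelopingMap torusProj D) :
    ∃ C : Matrix (Fin 2) (Fin 2) ℝ, ∀ p v,
      D (p + latticePoint (2 • v)) = D p + planeVector (C.mulVec fun i => (v i : ℝ)) := by
  have h1 : ∀ v, ∃ c, ∀ p, D (p + latticePoint (2 • v)) = D p + c := fun v => by
    obtain ⟨T, ⟨ε, δ, c, d, hε, hδ, hT⟩, h⟩ := hD.exists_isSignedScaling_deck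
      isCoveringMap_torusProj.isLocalHomeomorph (H := fun p => p + latticePoint v) (by fun_prop)
      fun q => by simp
    -- Since `ε ^ 2 = δ ^ 2 = 1`, the square of the signed isometry is a translation; hence the
    -- factor `2` on lattice vectors.
    refine ⟨(ε * c + c, δ * d + d), fun p => ?_⟩
    rw [two_nsmul, map_add, ← add_assoc, h, h, hT, hT]
    rcases hε with rfl | rfl <;> rcases hδ with rfl | rfl <;> (ext <;> simp <;> ring)
  choose c hc using h1
  have hadd : ∀ v w, c (v + w) = c v + c w := fun v w => by
    have := hc (v + w) 0
    rw [smul_add, map_add, ← add_assoc, hc w, hc v, add_assoc] at this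
    exact (add_left_cancel this).symm
  let L : (Fin 2 → ℤ) →+ ℝ × ℝ := AddMonoidHom.mk' c hadd
  refine ⟨Matrix.of fun i j => planeVector.symm (L (Pi.single j 1)) i, fun p v => ?_⟩
  rw [hc, add_right_inj]
  have hv : v = v 0 • Pi.single 0 1 + v 1 • Pi.single 1 1 := by
    ext i; fin_cases i <;> simp
  have : c v = v 0 • L (Pi.single 0 1) + v 1 • L (Pi.single 1 1) := by
    rw [← map_zsmul, ← map_zsmul, ← map_add, ← hv]; rfl
  apply planeVector.symm.injective
  rw [this, ContinuousLinearEquiv.symm_apply_apply, map_add, map_zsmul, map_zsmul]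
  ext i
  simp [Matrix.mulVec, dotProduct, mul_comm]

/-- The difference between `D` and the linear map `C / 2` is periodic, hence bounded, and an
invertible linear map is proper. -/
theorem isProperMap_of_periodMatrix {C : Matrix (Fin 2) (Fin 2) ℝ} (hC : C.det ≠ 0)
    {D : ℝ × ℝ → ℝ × ℝ} (hDc : Continuous D)
    (h : ∀ p v, D (p + latticePoint (2 • v)) = D p + planeVector (C.mulVec fun i => (v i : ℝ))) :
    IsProperMap D := by
  rw [isProperMap_iff_tendsto_cocompact]
  refine ⟨hDc, ?_⟩
  let e : (Fin 2 → ℝ) ≃L[ℝ] (Fin 2 → ℝ) :=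
    (Matrix.toLin'OfInv (Matrix.nonsing_inv_mul C (isUnit_iff_ne_zero.2 hC))
      (Matrix.mul_nonsing_inv C (isUnit_iff_ne_zero.2 hC))).toContinuousLinearEquiv
  have he : ∀ u, e u = C.mulVec u := fun u => Matrix.toLin'_apply C u
  let L : (ℝ × ℝ) ≃L[ℝ] ℝ × ℝ := (planeVector.symm.trans e).trans planeVector
  have hper : ∀ p v, (fun q => D q - L ((2 : ℝ)⁻¹ • q)) (p + latticePoint (2 • v)) =
      (fun q => D q - L ((2 : ℝ)⁻¹ • q)) p := fun p v => by
    have hL : L ((2 : ℝ)⁻¹ • latticePoint (2 • v)) =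
        planeVector (C.mulVec fun i => (v i : ℝ)) := by
      rw [map_nsmul, ← Nat.cast_smul_eq_nsmul ℝ, smul_smul, latticePoint_eq_planeVector]
      simp [L, he]
    simp only [h, smul_add, map_add, hL]
    abel
  obtain ⟨M, hM⟩ := exists_bound_of_periodic
    (u := fun q => D q - L ((2 : ℝ)⁻¹ • q)) (by fun_prop) hper
  have h1 : Filter.Tendsto (fun q : ℝ × ℝ => ‖L ((2 : ℝ)⁻¹ • q)‖) (Filter.cocompact _)
      Filter.atTop :=
    (tendsto_norm_cocompact_atTop (E := ℝ × ℝ)).comp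
      ((L.toHomeomorph.isClosedEmbedding.tendsto_cocompact).comp
        (Homeomorph.smulOfNeZero (2 : ℝ)⁻¹ (by norm_num)).isClosedEmbedding.tendsto_cocompact)
  rw [← Metric.cobounded_eq_cocompact (α := ℝ × ℝ), ← tendsto_norm_atTop_iff_cobounded,
    Metric.cobounded_eq_cocompact]
  refine Filter.tendsto_atTop_mono (fun q => ?_) (Filter.tendsto_atTop_add_const_right _ (-M) h1)
  have := norm_sub_norm_le (L ((2 : ℝ)⁻¹ • q)) (D q)
  rw [norm_sub_rev] at this
  linarith [hM q]

/-! ### Hyperbolicity of the period matrix and of the lattice action -/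

section Anosov

variable {D : ℝ × ℝ → ℝ × ℝ} {C : Matrix (Fin 2) (Fin 2) ℝ} {H : ℝ × ℝ ≃ₜ ℝ × ℝ}
  {B : Matrix (Fin 2) (Fin 2) ℤ} {p q c d : ℝ}

theorem diagonal_mul_periodMatrix
    (hC : ∀ z v, D (z + latticePoint (2 • v)) = D z + planeVector (C.mulVec fun i => (v i : ℝ)))
    (hB : ∀ z v, H (z + latticePoint v) = H z + latticePoint (B.mulVec v))
    (hH : ∀ z, D (H z) = (p * (D z).1 + c, q * (D z).2 + d)) :
    Matrix.diagonal ![p, q] * C = C * B.map (Int.cast : ℤ → ℝ) := by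
  have key : ∀ v : Fin 2 → ℤ, (Matrix.diagonal ![p, q] * C).mulVec (fun i => (v i : ℝ)) =
      (C * B.map (Int.cast : ℤ → ℝ)).mulVec (fun i => (v i : ℝ)) := fun v => by
    have hBv : (fun i => ((B.mulVec v) i : ℝ)) =
        (B.map (Int.cast : ℤ → ℝ)).mulVec (fun i => (v i : ℝ)) :=
      funext fun i => RingHom.map_mulVec (Int.castRingHom ℝ) B v i
    have h1 := hH (latticePoint (2 • v))
    have h2 := hH 0
    rw [← zero_add (latticePoint (2 • v)), hB, Matrix.mulVec_smul, hC, hC, hBv, h2] at h1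
    simp only [planeVector_apply, Prod.fst_add, Prod.snd_add, Prod.mk_add_mk, Prod.mk.injEq] at h1
    rw [← Matrix.mulVec_mulVec, ← Matrix.mulVec_mulVec]
    ext i
    rw [Matrix.mulVec_diagonal]
    fin_cases i
    · change p * C.mulVec _ 0 = C.mulVec _ 0
      linarith [h1.1]
    · change q * C.mulVec _ 1 = C.mulVec _ 1
      linarith [h1.2]
  ext i j
  have := congrFun (key (Pi.single j 1)) i
  have hs : (fun i => ((Pi.single j 1 : Fin 2 → ℤ) i : ℝ)) = Pi.single j 1 := by
    ext k; by_cases h : k = j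
    · subst h; simp
    · simp [h]
  rw [hs, Matrix.mulVec_single_one, Matrix.mulVec_single_one] at this
  exact this

/-- A zero row would make a coordinate of `D` bounded; rescaled by `H`, it would be constant, which
a local homeomorphism excludes. The left kernel of `C` is invariant under `diag(p, q)`, so, as `p ≠
q`, a nonzero kernel would force a zero row. -/
theorem det_periodMatrix_ne_zero (hD : IsLocalHomeomorph D)
    (hC : ∀ z v, D (z + latticePoint (2 • v)) = D z + planeVector (C.mulVec fun i => (v i : ℝ)))
    (hB : ∀ z v, H (z + latticePoint v) = H z + latticePoint (B.mulVec v))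
    (hH : ∀ z, D (H z) = (p * (D z).1 + c, q * (D z).2 + d)) (hp : |p| ≠ 1) (hq : |q| ≠ 1)
    (hpq : p ≠ q) : C.det ≠ 0 := by
  have hDc := hD.continuous
  have row0 : C 0 ≠ 0 := fun h0 => by
    obtain ⟨M, hM⟩ := exists_bound_of_periodic (u := fun z => (D z).1) (by fun_prop)
      fun z v => by simp only [hC]; simp [planeVector_apply, h0]
    exact hD.not_forall_fst_eq _ fun z => eq_of_bounded_of_comp_eq (u := fun z => (D z).1)
      H.surjective hp (fun z => by rw [hH]) hM z 0
  have row1 : C 1 ≠ 0 := fun h0 => by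
    obtain ⟨M, hM⟩ := exists_bound_of_periodic (u := fun z => (D z).2) (by fun_prop)
      fun z v => by simp only [hC]; simp [planeVector_apply, h0]
    exact hD.not_forall_snd_eq _ fun z => eq_of_bounded_of_comp_eq (u := fun z => (D z).2)
      H.surjective hq (fun z => by rw [hH]) hM z 0
  have hCB := diagonal_mul_periodMatrix hC hB hH
  intro hdet
  obtain ⟨x, hx0, hx⟩ := Matrix.exists_vecMul_eq_zero_iff.2 hdet
  have h1 : ∀ j, x 0 * C 0 j + x 1 * C 1 j = 0 := fun j => by
    simpa [Matrix.vecMul, dotProduct] using congrFun hx j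
  have h2 : ∀ j, x 0 * (p * C 0 j) + x 1 * (q * C 1 j) = 0 := fun j => by
    have : Matrix.vecMul x (Matrix.diagonal ![p, q] * C) = 0 := by
      rw [hCB, ← Matrix.vecMul_vecMul, hx, Matrix.zero_vecMul]
    have := congrFun this j
    simpa [Matrix.vecMul, dotProduct, Matrix.diagonal_mul] using this
  apply hx0
  have e0 : x 0 = 0 := by
    by_contra h
    refine row0 (funext fun j => ?_)
    have : (p - q) * (x 0 * C 0 j) = 0 := by linear_combination h2 j - q * h1 j
    simpa [sub_ne_zero.2 hpq, h] using this
  have e1 : x 1 = 0 := by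
    by_contra h
    refine row1 (funext fun j => ?_)
    have : (p - q) * (x 1 * C 1 j) = 0 := by linear_combination p * h1 j - h2 j
    simpa [sub_ne_zero.2 hpq, h] using this
  ext i; fin_cases i
  · exact e0
  · exact e1

/-- `C` conjugates `n - B` to `diag(n - p, n - q)`. -/
theorem det_natCast_sub_ne_zero {n : ℕ} (hdet : C.det ≠ 0)
    (hCB : Matrix.diagonal ![p, q] * C = C * B.map (Int.cast : ℤ → ℝ)) (hp : p ≠ n) (hq : q ≠ n) :
    ((n : Matrix (Fin 2) (Fin 2) ℤ) - B).det ≠ 0 := by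
  intro h
  have h1 : ((n : Matrix (Fin 2) (Fin 2) ℝ) - B.map (Int.cast : ℤ → ℝ)).det = 0 := by
    have := congrArg (Int.castRingHom ℝ) h
    rw [RingHom.map_det, map_zero, map_sub, map_natCast] at this
    exact this
  have h2 : C * ((n : Matrix (Fin 2) (Fin 2) ℝ) - B.map (Int.cast : ℤ → ℝ)) =
      Matrix.diagonal ![n - p, n - q] * C := by
    rw [mul_sub, ← hCB, (Nat.cast_commute n C).symm.eq, ← sub_mul]
    congr 1
    ext i j
    fin_cases i <;> fin_cases j <;> simp [Matrix.natCast_apply]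
  have h3 := congrArg Matrix.det h2
  rw [Matrix.det_mul, h1, mul_zero, Matrix.det_mul, Matrix.det_diagonal, Fin.prod_univ_two] at h3
  have : ((n : ℝ) - p) * (n - q) ≠ 0 :=
    mul_ne_zero (sub_ne_zero.2 hp.symm) (sub_ne_zero.2 hq.symm)
  exact mul_ne_zero this hdet h3.symm

theorem sq_eq_one_of_mul_eq_pow_mul {A : Matrix (Fin 2) (Fin 2) ℤ} {n : ℕ} (hn : 2 ≤ n) {lam : ℝ}
    (hlam : n < lam) (hp : |p| = lam) (hq : |q| = lam⁻¹) (hdet : C.det ≠ 0)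
    (hCB : Matrix.diagonal ![p, q] * C = C * B.map (Int.cast : ℤ → ℝ)) (hA : A.det ≠ 0)
    (hBA : B * A = A ^ n * B) : A ^ 2 = 1 := by
  let φ := (Int.castRingHom ℝ).mapMatrix (m := Fin 2)
  have hφ : Function.Injective φ := Matrix.map_injective Int.cast_injective
  have hCC : C * C⁻¹ = 1 := Matrix.mul_nonsing_inv C (isUnit_iff_ne_zero.2 hdet)
  have hCC' : C⁻¹ * C = 1 := Matrix.nonsing_inv_mul C (isUnit_iff_ne_zero.2 hdet)
  have hCB' : Matrix.diagonal ![p, q] * C = C * φ B := hCB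
  have hpow : ∀ k, (C * φ A * C⁻¹) ^ k = C * φ (A ^ k) * C⁻¹ := fun k => by
    have : SemiconjBy C (φ A) (C * φ A * C⁻¹) := by
      rw [SemiconjBy, mul_assoc _ _ C, hCC', mul_one]
    have := (this.pow_right k).eq
    rw [map_pow, this, mul_assoc (_ ^ k), hCC, mul_one]
  have hM : (C * φ A * C⁻¹) ^ 2 = 1 := by
    refine Matrix.sq_eq_one_of_diagonal_mul_eq hn hlam hp hq ?_ ?_
    · have : (φ A).det = (A.det : ℝ) := ((Int.castRingHom ℝ).map_det A).symm
      rw [Matrix.det_mul, Matrix.det_mul, this, mul_right_comm, ← Matrix.det_mul, hCC,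
        Matrix.det_one, one_mul]
      exact_mod_cast hA
    · rw [hpow]
      calc _ = (Matrix.diagonal ![p, q] * C) * φ A * C⁻¹ := by simp only [mul_assoc]
        _ = C * φ (B * A) * C⁻¹ := by rw [hCB', map_mul]; simp only [mul_assoc]
        _ = C * φ (A ^ n) * (C⁻¹ * C) * φ B * C⁻¹ := by
          rw [hBA, map_mul, hCC', mul_one]; simp only [mul_assoc]
        _ = C * φ (A ^ n) * C⁻¹ * (Matrix.diagonal ![p, q] * (C * C⁻¹)) := by
          rw [← mul_assoc _ C C⁻¹, hCB']; simp only [mul_assoc]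
        _ = _ := by rw [hCC, mul_one]
  rw [hpow] at hM
  apply hφ
  rw [map_one]
  calc φ (A ^ 2) = (C⁻¹ * C) * φ (A ^ 2) * (C⁻¹ * C) := by rw [hCC', one_mul, mul_one]
    _ = C⁻¹ * (C * φ (A ^ 2) * C⁻¹) * C := by simp only [mul_assoc]
    _ = 1 := by rw [hM, mul_one, hCC']

end Anosov

/-! ### Lifting the relation, and finite order -/

theorem lift_pow_add_latticePoint {F : ℝ × ℝ ≃ₜ ℝ × ℝ} {A : Matrix (Fin 2) (Fin 2) ℤ}
    (hA : ∀ p v, F (p + latticePoint v) = F p + latticePoint (A.mulVec v)) (k : ℕ)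
    (p : ℝ × ℝ) (v : Fin 2 → ℤ) :
    (F ^ k) (p + latticePoint v) = (F ^ k) p + latticePoint ((A ^ k).mulVec v) := by
  induction k generalizing p v with
  | zero => simp
  | succ k ih => rw [pow_succ, Homeomorph.mul_apply, hA, ih, Matrix.mulVec_mulVec, ← pow_succ,
      Homeomorph.mul_apply]

theorem det_ne_zero_of_lift {f : Torus2 ≃ₜ Torus2} {F : ℝ × ℝ ≃ₜ ℝ × ℝ}
    (hF : ∀ p, torusProj (F p) = f (torusProj p)) {A : Matrix (Fin 2) (Fin 2) ℤ}
    (hA : ∀ p v, F (p + latticePoint v) = F p + latticePoint (A.mulVec v)) : A.det ≠ 0 := by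
  obtain ⟨A', hA'⟩ := exists_matrix_of_lift (f := f.symm) F.symm.continuous fun p => by
    rw [← f.injective.eq_iff, ← hF]; simp
  have : A * A' = 1 := Matrix.mulVec_injective (funext fun v => latticePoint_injective (by
    have := congrArg F (hA' 0 v)
    rw [hA, F.apply_symm_apply, F.apply_symm_apply, Matrix.mulVec_mulVec] at this
    rw [Matrix.one_mulVec, ← add_left_cancel this]))
  intro h
  have := congrArg Matrix.det this
  rw [Matrix.det_mul, h, zero_mul, Matrix.det_one] at this
  exact zero_ne_one this

theorem exists_deck_mul_of_lift {f h : Torus2 ≃ₜ Torus2} {n : ℕ} (hrel : h * f = f ^ n * h)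
    {F H : ℝ × ℝ ≃ₜ ℝ × ℝ} (hF : ∀ p, torusProj (F p) = f (torusProj p))
    (hH : ∀ p, torusProj (H p) = h (torusProj p)) : ∃ v, H * F = deck v * F ^ n * H := by
  obtain ⟨v, hv⟩ := exists_eq_add_latticePoint (F := fun p => (H * F) p)
    (G := fun p => (F ^ n * H) p) (H * F).continuous (F ^ n * H).continuous fun p => by
      rw [Homeomorph.mul_apply, Homeomorph.mul_apply, hH, hF, pow_lift hF, hH,
        ← Homeomorph.mul_apply, hrel, Homeomorph.mul_apply]
  exact ⟨v, by ext1 p; rw [hv]; simp⟩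

/-- The deck translation by which the lifted relation fails does not affect the action on the
lattice. -/
theorem mul_eq_pow_mul_of_lift {f h : Torus2 ≃ₜ Torus2} {n : ℕ} (hrel : h * f = f ^ n * h)
    {F H : ℝ × ℝ ≃ₜ ℝ × ℝ} (hF : ∀ p, torusProj (F p) = f (torusProj p))
    (hH : ∀ p, torusProj (H p) = h (torusProj p)) {A B : Matrix (Fin 2) (Fin 2) ℤ}
    (hA : ∀ p v, F (p + latticePoint v) = F p + latticePoint (A.mulVec v))
    (hB : ∀ p v, H (p + latticePoint v) = H p + latticePoint (B.mulVec v)) :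
    B * A = A ^ n * B := by
  obtain ⟨u, hu⟩ := exists_deck_mul_of_lift hrel hF hH
  replace hu : ∀ p, (H * F) p = (F ^ n * H) p + latticePoint u := fun p => by rw [hu]; simp
  refine Matrix.mulVec_injective (funext fun v => latticePoint_injective ?_)
  have h1 := hu (0 + latticePoint v)
  rw [Homeomorph.mul_apply, Homeomorph.mul_apply, hA, hB, hB, lift_pow_add_latticePoint hA,
    ← Homeomorph.mul_apply, ← Homeomorph.mul_apply, hu, add_right_comm, add_left_inj,
    Matrix.mulVec_mulVec, Matrix.mulVec_mulVec] at h1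
  exact add_left_cancel h1

/-- A torus homeomorphism that an Anosov homeomorphism of stretch factor larger than `n` conjugates
to its `n`-th power has finite order. -/
theorem IsAnosovWithStretchFactor.exists_pow_eq_one {f h : Torus2 ≃ₜ Torus2} {n : ℕ} (hn : 2 ≤ n)
    {lam : ℝ} (hlam : n < lam) (hh : IsAnosovWithStretchFactor h lam)
    (hrel : h * f = f ^ n * h) : ∃ k : ℕ, 0 < k ∧ f ^ k = 1 := by
  obtain ⟨hlam1, 𝓕, h𝓕⟩ := hh
  have hn' : (2 : ℝ) ≤ n := by exact_mod_cast hn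
  have hlam0 : 0 < lam := by linarith
  have hinv : lam⁻¹ < 1 := inv_lt_one_of_one_lt₀ hlam1
  have hπ := isCoveringMap_torusProj.isLocalHomeomorph
  obtain ⟨D, hD⟩ := 𝓕.exists_developingMap continuous_torusProj
  replace hD : 𝓕.IsDevelopingMap torusProj D := hD
  have hDloc := hD.isLocalHomeomorph hπ
  obtain ⟨F, hF⟩ := exists_homeomorph_lift f
  obtain ⟨H, hH⟩ := exists_homeomorph_lift h
  obtain ⟨A, hA⟩ := exists_matrix_of_lift F.continuous hF
  obtain ⟨B, hB⟩ := exists_matrix_of_lift H.continuous hH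
  obtain ⟨C, hC⟩ := exists_periodMatrix hD
  obtain ⟨T, hT, hDH⟩ := hD.exists_isSignedScaling_comp hπ h𝓕 H.continuous hH
  obtain ⟨p, q, c, d, hp, hq, hT'⟩ : ∃ p q c d : ℝ, |p| = lam ∧ |q| = lam⁻¹ ∧
      ∀ z, T z = (p * z.1 + c, q * z.2 + d) := by
    obtain ⟨ε, δ, c, d, hε, hδ, hT'⟩ := hT
    refine ⟨ε * lam, δ * lam⁻¹, c, d, ?_, ?_, hT'⟩
    · rcases hε with rfl | rfl <;> simp [abs_of_pos hlam0]
    · rcases hδ with rfl | rfl <;> simp [abs_of_pos hlam0]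
  have hDH' : ∀ z, D (H z) = (p * (D z).1 + c, q * (D z).2 + d) := fun z => by rw [hDH, hT']
  have hdet : C.det ≠ 0 := det_periodMatrix_ne_zero hDloc hC hB hDH' (by rw [hp]; exact hlam1.ne')
    (by rw [hq]; exact hinv.ne) (by rintro rfl; linarith)
  have hCB := diagonal_mul_periodMatrix hC hB hDH'
  have hA2 : A ^ 2 = 1 := sq_eq_one_of_mul_eq_pow_mul hn hlam hp hq hdet hCB
    (det_ne_zero_of_lift hF hA) (mul_eq_pow_mul_of_lift hrel hF hH hA hB)
  have hdet' := det_natCast_sub_ne_zero (n := n) hdet hCB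
    (by rintro rfl; rw [abs_of_nonneg (by linarith)] at hp; linarith)
    (by rintro rfl; rw [abs_of_nonneg (by linarith)] at hq; linarith)
  have hF2 : ∀ v, Commute (F ^ 2) (deck v) := fun v => by
    ext1 z
    rw [Homeomorph.mul_apply, Homeomorph.mul_apply, deck_apply, deck_apply,
      lift_pow_add_latticePoint hA, hA2, Matrix.one_mulVec]
  have hrel2 : h * f ^ 2 = (f ^ 2) ^ n * h := by
    have : SemiconjBy h f (f ^ n) := hrel
    rw [← pow_mul, mul_comm 2 n, pow_mul]
    exact this.pow_right 2
  obtain ⟨v, hv⟩ := exists_deck_mul_of_lift hrel2 (pow_lift hF 2) hH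
  obtain ⟨k, hk, w, hw⟩ := exists_corrected_lift (H := H) (G := F ^ 2) (v := v)
    (fun v => by ext1 z; simp [hB]) hF2 hdet'
    hv
  set G := deck w * (F ^ 2) ^ k with hG
  obtain ⟨e, he⟩ := hDloc.exists_homeomorph_of_isProperMap
    (isProperMap_of_periodMatrix hdet hDloc.continuous hC)
  have hGper : ∀ z v, G (z + latticePoint v) = G z + latticePoint v := fun z v => by
    have : Commute G (deck v) := by
      refine Commute.mul_left ?_ ((hF2 v).pow_left k)
      rw [commute_iff_eq, ← deck_add, ← deck_add, add_comm]
    exact congrArg (fun K : ℝ × ℝ ≃ₜ ℝ × ℝ => K z) this.eq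
  have hDc := hDloc.continuous
  -- As `G` commutes with deck translations, `D ∘ G - D` is periodic, which bounds the displacement
  -- of `e * G * e⁻¹`.
  obtain ⟨M, hM⟩ := exists_bound_of_periodic (u := fun z => D (G z) - D z) (by fun_prop)
    fun z v => by simp only [hC, hGper]; abel
  have hfix : ∀ z, (e * G * e⁻¹) z = z := by
    refine eq_self_of_isSignedScaling_conj (by omega : 1 ≤ n) hlam hT (fun z => ?_) (M₀ := M)
      fun z => ?_
    · obtain ⟨y, rfl⟩ := e.surjective z
      have hey : e⁻¹ (e y) = y := e.symm_apply_apply y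
      have hTe : ∀ y, T (e y) = e (H y) := fun y => by rw [he, he, hDH]
      have heH : e⁻¹ (e (H y)) = H y := e.symm_apply_apply _
      have hHG : H (G y) = (G ^ n) (H y) := congrArg (fun K : ℝ × ℝ ≃ₜ ℝ × ℝ => K y) hw
      rw [conj_pow, (e * G).mul_apply, e.mul_apply, hey, hTe, hTe, (e * G ^ n).mul_apply,
        e.mul_apply, heH, hHG]
    · obtain ⟨y, rfl⟩ := e.surjective z
      have hey : e⁻¹ (e y) = y := e.symm_apply_apply y
      rw [Homeomorph.mul_apply, Homeomorph.mul_apply, hey, he, he]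
      exact hM y
  have hG1 : ∀ z, G z = z := fun z => e.injective (by
    have hey : e⁻¹ (e z) = z := e.symm_apply_apply z
    have := hfix (e z)
    rwa [Homeomorph.mul_apply, Homeomorph.mul_apply, hey] at this)
  refine ⟨2 * k, by omega, ?_⟩
  ext1 x
  obtain ⟨z, rfl⟩ := isOpenQuotientMap_torusProj.surjective x
  have := congrArg torusProj (hG1 z)
  rw [hG, Homeomorph.mul_apply, deck_apply, map_add, torusProj_latticePoint, add_zero,
    pow_lift (pow_lift hF 2), ← pow_mul] at this
  rw [this, Homeomorph.one_apply]

/-! ### The generator `b` has infinite order -/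

namespace BaumslagSolitar

theorem a_mul_b (n : ℕ) : a 1 (n : ℤ) * b 1 (n : ℤ) = b 1 (n : ℤ) ^ n * a 1 (n : ℤ) := by
  have h := PresentedGroup.one_of_mem (rels := ({FreeGroup.of 0 * FreeGroup.of 1 ^ (1 : ℤ) *
    (FreeGroup.of 0)⁻¹ * (FreeGroup.of 1 ^ (n : ℤ))⁻¹} : Set (FreeGroup (Fin 2)))) rfl
  simp only [map_mul, map_inv, map_pow, zpow_one, zpow_natCast] at h
  rw [mul_inv_eq_one, mul_inv_eq_iff_eq_mul] at h
  exact h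

/-- The affine action on `ℚ`, with `a` acting as `x ↦ n x` and `b` as `x ↦ x + 1`, detects the
powers of `b`. -/
theorem b_pow_ne_one {n k : ℕ} (hn : n ≠ 0) (hk : 0 < k) : b 1 (n : ℤ) ^ k ≠ 1 := by
  have hn' : (n : ℚ) ≠ 0 := by exact_mod_cast hn
  let α : Equiv.Perm ℚ := Equiv.mulLeft₀ (n : ℚ) hn'
  let β : Equiv.Perm ℚ := Equiv.addRight 1
  have hβ : ∀ (j : ℕ) x, (β ^ j) x = x + j := fun j => by
    induction j with
    | zero => simp
    | succ j ih => intro x; rw [pow_succ', Equiv.Perm.mul_apply, ih]; simp [β, add_assoc]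
  have hrel : ∀ r ∈ ({FreeGroup.of 0 * FreeGroup.of 1 ^ (1 : ℤ) *
      (FreeGroup.of 0)⁻¹ * (FreeGroup.of 1 ^ (n : ℤ))⁻¹} : Set (FreeGroup (Fin 2))),
      FreeGroup.lift ![α, β] r = 1 := by
    rintro r rfl
    simp only [map_mul, map_inv, map_pow, zpow_one, zpow_natCast, FreeGroup.lift_apply_of]
    rw [mul_inv_eq_one, mul_inv_eq_iff_eq_mul]
    ext x
    change α (β x) = (β ^ n) (α x)
    rw [hβ]
    simp [α, β, mul_add]
  intro h
  have h1 := congrArg (PresentedGroup.toGroup hrel) h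
  rw [map_pow, map_one, b, PresentedGroup.toGroup.of] at h1
  have h2 := congrArg (fun σ : Equiv.Perm ℚ => σ 0) h1
  change (β ^ k) 0 = 0 at h2
  rw [hβ, zero_add] at h2
  exact hk.ne' (by exact_mod_cast h2)

end BaumslagSolitar

theorem mainTheorem4 (n : ℕ) (hn : 2 ≤ n) (lam : ℝ) (hlam : (n : ℝ) < lam)
    (ρ : BaumslagSolitar 1 (n : ℤ) →* (Torus2 ≃ₜ Torus2))
    (hρ : IsAnosovWithStretchFactor (ρ (BaumslagSolitar.a 1 (n : ℤ))) lam) :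
    ¬ Function.Injective ρ := by
  intro hinj
  obtain ⟨k, hk, h⟩ := hρ.exists_pow_eq_one (f := ρ (BaumslagSolitar.b 1 (n : ℤ))) hn hlam
    (by rw [← map_mul, BaumslagSolitar.a_mul_b, map_mul, map_pow])
  rw [← map_pow, ← map_one ρ] at h
  exact BaumslagSolitar.b_pow_ne_one (by omega) hk (hinj h)
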